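/- Let $E$ and $F$ be real Banach lattices, with norm duals $E^*$ and $F^*$, where $E^*$ carries the dual order. A bounded linear operator $T:E\to F$ is called \emph{weak Dunford--Pettis} if $f_n(Tx_n)\to 0$ for every weakly null sequence $(x_n)$ in $E$ and every weakly null sequence $(f_n)$ in $F^*$, and \emph{limited} if every weak$^*$-null sequence $(f_n)$ in $F^*$ converges to $0$ uniformly on the image $T(B_E)$ of the closed unit ball of $E$. If every positive weak Dunford--Pettis operator $T:E\to F$ is limited, then at least one of the following holds: (i) $E^*$ is a KB-space, that is, every norm bounded increasing sequence of positive elements of $E^*$ is norm convergent; (ii) $F^*$ has the Schur property, that is, every weakly null sequence in $F^*$ is norm null. -/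

import Mathlib

open Filter Topology

/-- The sequence `x` converges to `0` in the weak topology `σ(X, X*)`. -/
def WeaklyNull {X : Type*} [NormedAddCommGroup X] [NormedSpace ℝ X] (x : ℕ → X) : Prop :=
  Tendsto (fun n => toWeakSpace ℝ X (x n)) atTop (𝓝 0)

/-- The sequence `f` of functionals converges to `0` in the weak* topology `σ(X*, X)`. -/
def WeakStarNull {X : Type*} [NormedAddCommGroup X] [NormedSpace ℝ X]
    (f : ℕ → StrongDual ℝ X) : Prop :=
  Tendsto (fun n => StrongDual.toWeakDual (f n)) atTop (𝓝 0)

/-- The Schur property: every weakly null sequence is norm null. -/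
def HasSchurProperty (X : Type*) [NormedAddCommGroup X] [NormedSpace ℝ X] : Prop :=
  ∀ x : ℕ → X, WeaklyNull x → Tendsto (fun n => ‖x n‖) atTop (𝓝 0)

/-- A bounded set is limited if every weak* null sequence of functionals converges to `0`
uniformly on it. -/
def IsLimitedSet {X : Type*} [NormedAddCommGroup X] [NormedSpace ℝ X] (A : Set X) : Prop :=
  Bornology.IsBounded A ∧ ∀ f : ℕ → StrongDual ℝ X, WeakStarNull f →
    TendstoUniformlyOn (fun n x => f n x) (fun _ => (0 : ℝ)) atTop A

/-- An operator is limited if it maps the closed unit ball onto a limited set. -/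
def IsLimitedOperator {X Y : Type*} [NormedAddCommGroup X] [NormedSpace ℝ X]
    [NormedAddCommGroup Y] [NormedSpace ℝ Y] (T : X →L[ℝ] Y) : Prop :=
  IsLimitedSet (T '' Metric.closedBall (0 : X) 1)

/-- Weak Dunford–Pettis operators: `fₙ (T xₙ) → 0` for all weakly null `(xₙ)` in `X` and all
weakly null (that is, `σ(Y*, Y**)`-null) `(fₙ)` in `Y*`. -/
def IsWeakDunfordPettis {X Y : Type*} [NormedAddCommGroup X] [NormedSpace ℝ X]
    [NormedAddCommGroup Y] [NormedSpace ℝ Y] (T : X →L[ℝ] Y) : Prop :=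
  ∀ (x : ℕ → X) (f : ℕ → StrongDual ℝ Y), WeaklyNull x → WeaklyNull f →
    Tendsto (fun n => f n (T (x n))) atTop (𝓝 0)

/-- A positive operator maps the positive cone into the positive cone. -/
def IsPositiveOperator {E F : Type*} [NormedAddCommGroup E] [NormedSpace ℝ E] [Lattice E]
    [NormedAddCommGroup F] [NormedSpace ℝ F] [Lattice F] (T : E →L[ℝ] F) : Prop :=
  ∀ x : E, 0 ≤ x → 0 ≤ T x

/-- The dual order on `E*`: `f ≤ g` if and only if `f x ≤ g x` for all `x ≥ 0`. -/
instance dualPartialOrder {E : Type*} [NormedAddCommGroup E] [NormedSpace ℝ E] [Lattice E]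
    [IsOrderedAddMonoid E] : PartialOrder (StrongDual ℝ E) where
  le f g := ∀ x : E, 0 ≤ x → f x ≤ g x
  le_refl _ _ _ := le_rfl
  le_trans _ _ _ hfg hgh x hx := (hfg x hx).trans (hgh x hx)
  le_antisymm f g hfg hgf := by
    have key : ∀ x : E, 0 ≤ x → f x = g x := fun x hx => le_antisymm (hfg x hx) (hgf x hx)
    ext x
    rw [← posPart_sub_negPart x, map_sub, map_sub, key _ (posPart_nonneg x),
      key _ (negPart_nonneg x)]

/-- KB-spaces: every norm bounded increasing sequence of positive elements converges in norm.
The condition on a Banach lattice `G` involves only its norm and its order, so only these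
are arguments of the definition. -/
def IsKBSpace (G : Type*) [NormedAddCommGroup G] [PartialOrder G] : Prop :=
  ∀ x : ℕ → G, Monotone x → (∀ n, 0 ≤ x n) → Bornology.IsBounded (Set.range x) →
    ∃ l : G, Tendsto x atTop (𝓝 l)

/-! Suppose both alternatives fail. Increments of a bounded increasing non-Cauchy sequence give
positive `φ k` in `E*`, bounded away from `0` in norm, with `x ↦ (φ k x)ₖ` bounded into `ℓ¹`.
Failure of Schur in `F*` gives a weakly null `f` and positive `y k` in the unit ball with `|f k (y
k)|` bounded below. The positive operator `T x = ∑ φ k x • y k` factors through `ℓ¹`, so Schur's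
theorem there makes it weak Dunford–Pettis. After passing to subsequences, the diagonal term
dominates `f n (T (u n))` for suitable `u n` in the unit ball, so `T` is not limited
(`sub_le_tsum_mul`). -/

theorem WeaklyNull.tendsto_apply {X : Type*} [NormedAddCommGroup X] [NormedSpace ℝ X]
    {x : ℕ → X} (hx : WeaklyNull x) (f : StrongDual ℝ X) :
    Tendsto (fun n => f (x n)) atTop (𝓝 0) := by
  have h : Tendsto (fun n => f (x n)) atTop (𝓝 (f 0)) :=
    ((WeakBilin.eval_continuous (topDualPairing ℝ X).flip f).tendsto 0).comp hx
  rwa [map_zero] at h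

theorem WeaklyNull.tendsto_apply_apply {X : Type*} [NormedAddCommGroup X] [NormedSpace ℝ X]
    {f : ℕ → StrongDual ℝ X} (hf : WeaklyNull f) (x : X) :
    Tendsto (fun n => f n x) atTop (𝓝 0) :=
  hf.tendsto_apply (NormedSpace.inclusionInDoubleDual ℝ X x)

theorem WeaklyNull.weakStarNull {X : Type*} [NormedAddCommGroup X] [NormedSpace ℝ X]
    {f : ℕ → StrongDual ℝ X} (hf : WeaklyNull f) : WeakStarNull f := by
  unfold WeakStarNull
  rw [tendsto_iff_forall_eval_tendsto_topDualPairing]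
  intro x
  have h : Tendsto (fun n => f n x) atTop (𝓝 ((0 : StrongDual ℝ X) x)) :=
    hf.tendsto_apply_apply x
  exact h

theorem WeaklyNull.exists_norm_le {X : Type*} [NormedAddCommGroup X] [NormedSpace ℝ X]
    [CompleteSpace X] {f : ℕ → StrongDual ℝ X} (hf : WeaklyNull f) : ∃ C, ∀ n, ‖f n‖ ≤ C := by
  refine banach_steinhaus fun x => ?_
  obtain ⟨C, hC⟩ := (hf.tendsto_apply_apply x).norm.bddAbove_range
  exact ⟨C, fun n => hC ⟨n, rfl⟩⟩

/-! ### Schur's theorem and operators factoring through `ℓ¹` -/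

/-- Schur's theorem for `ℓ¹`, for the rows of a matrix. -/
theorem tendsto_tsum_abs_of_forall_tendsto_tsum_mul {a : ℕ → ℕ → ℝ}
    (ha : ∀ n, Summable fun k => |a n k|)
    (h : ∀ s : ℕ → ℝ, (∀ k, |s k| ≤ 1) →
      Tendsto (fun n => ∑' k, s k * a n k) atTop (𝓝 0)) :
    Tendsto (fun n => ∑' k, |a n k|) atTop (𝓝 0) := by
  classical
  have hcol : ∀ k, Tendsto (fun n => a n k) atTop (𝓝 0) := fun k => by
    have := h (Pi.single k 1) fun j => by
      by_cases hj : j = k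
      · subst hj; simp
      · simp [hj]
    refine this.congr fun n => ?_
    rw [tsum_eq_single k fun j hj => by simp [hj]]
    simp
  have hs1 : ∀ (s : ℕ → Set.Icc (-1 : ℝ) 1) k, |(s k : ℝ)| ≤ 1 := fun s k =>
    abs_le.2 (s k).2
  have hle : ∀ (s : ℕ → ℝ) (_ : ∀ k, |s k| ≤ 1) n k, ‖s k * a n k‖ ≤ |a n k| :=
    fun s hs n k => by
      rw [Real.norm_eq_abs, abs_mul]
      exact mul_le_of_le_one_left (abs_nonneg _) (hs k)
  have hcont : ∀ n, Continuous fun s : ℕ → Set.Icc (-1 : ℝ) 1 => ∑' k, (s k : ℝ) * a n k :=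
    fun n => continuous_tsum (fun k => by fun_prop) (ha n) fun k s => hle _ (hs1 s) n k
  rw [Metric.tendsto_atTop]
  intro ε hε
  -- Baire category on the cube `[-1, 1]^ℕ`: these closed sets cover it, so one contains a basic
  -- open set, which constrains only finitely many coordinates `I`.
  let C : ℕ → Set (ℕ → Set.Icc (-1 : ℝ) 1) := fun N =>
    {s | ∀ n ≥ N, |∑' k, (s k : ℝ) * a n k| ≤ ε / 4}
  have hCclosed : ∀ N, IsClosed (C N) := fun N => by
    simp only [C, Set.ofPred_forall]
    exact isClosed_iInter fun n => isClosed_iInter fun _ =>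
      isClosed_le (hcont n).abs continuous_const
  have hCcover : ⋃ N, C N = Set.univ := by
    refine Set.eq_univ_of_forall fun s => Set.mem_iUnion.2 ?_
    obtain ⟨N, hN⟩ := Metric.tendsto_atTop.1 (h (fun k => s k) (hs1 s)) (ε / 4) (by linarith)
    exact ⟨N, fun n hn => by simpa using (hN n hn).le⟩
  have : Nonempty (Set.Icc (-1 : ℝ) 1) := ⟨⟨0, by simp⟩⟩
  obtain ⟨N, s, hsN⟩ := nonempty_interior_of_iUnion_of_closed hCclosed hCcover
  obtain ⟨I, u, hu, hIu⟩ := isOpen_pi_iff.1 isOpen_interior s hsN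
  have hfin : Tendsto (fun n => ∑ k ∈ I, |a n k|) atTop (𝓝 0) := by
    simpa using tendsto_finsetSum I fun k _ => (hcol k).abs
  obtain ⟨N', hN'⟩ := Metric.tendsto_atTop.1 hfin (ε / 4) (by linarith)
  refine ⟨max N N', fun n hn => ?_⟩
  have hI : ∑ k ∈ I, |a n k| < ε / 4 := by
    have := hN' n (le_of_max_le_right hn)
    rw [Real.dist_0_eq_abs] at this
    exact (le_abs_self _).trans_lt this
  -- Off `I` the coordinates are free, so they can be the signs of row `n`, and the pairing recovers
  -- the `ℓ¹` norm up to the small sum over `I`.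
  let t : ℕ → Set.Icc (-1 : ℝ) 1 := fun k =>
    if k ∈ I then s k else ⟨SignType.sign (a n k), by
      rcases lt_trichotomy (a n k) 0 with hk | hk | hk <;> simp [hk]⟩
  have ht : t ∈ C N := interior_subset (hIu fun k hk => by
    simpa [t, Finset.mem_coe.1 hk] using (hu k hk).2)
  have htn := ht n (le_of_max_le_left hn)
  have hsum : Summable fun k => (t k : ℝ) * a n k :=
    Summable.of_norm_bounded (ha n) fun k => hle _ (hs1 t) n k
  have hdiff : ∑' k, |a n k| - ∑' k, (t k : ℝ) * a n k
      = ∑ k ∈ I, (|a n k| - (t k : ℝ) * a n k) := by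
    rw [← (ha n).tsum_sub hsum]
    refine tsum_eq_sum fun k hk => ?_
    simp [t, hk, sign_mul_self]
  have hdiff_le : ∑ k ∈ I, (|a n k| - (t k : ℝ) * a n k) ≤ ∑ k ∈ I, 2 * |a n k| :=
    Finset.sum_le_sum fun k _ => by
      have := (abs_le.1 (hle _ (hs1 t) n k)).1
      linarith
  rw [← Finset.mul_sum] at hdiff_le
  rw [Real.dist_0_eq_abs, abs_of_nonneg (tsum_nonneg fun k => abs_nonneg _)]
  have := (abs_le.1 htn).2
  linarith

/-- If `x ↦ (φ k x)ₖ` is bounded into `ℓ¹` and `y` is a sequence in the unit ball, then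
`x ↦ ∑ φ k x • y k` is a bounded operator. -/
theorem exists_clm_hasSum_smul {X Y : Type*} [NormedAddCommGroup X] [NormedSpace ℝ X]
    [NormedAddCommGroup Y] [NormedSpace ℝ Y] [CompleteSpace Y] {φ : ℕ → StrongDual ℝ X} {M : ℝ}
    (hφ : ∀ (x : X) (s : Finset ℕ), ∑ k ∈ s, |φ k x| ≤ M * ‖x‖) {y : ℕ → Y}
    (hy : ∀ k, ‖y k‖ ≤ 1) :
    ∃ T : X →L[ℝ] Y, (∀ x, HasSum (fun k => φ k x • y k) (T x)) ∧
      ∀ x, ‖T x‖ ≤ ∑' k, |φ k x| := by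
  have hsum : ∀ x, Summable fun k => |φ k x| := fun x =>
    summable_of_sum_le (fun k => abs_nonneg _) (hφ x)
  have hle : ∀ x k, ‖φ k x • y k‖ ≤ |φ k x| := fun x k => by
    rw [norm_smul, Real.norm_eq_abs]
    exact mul_le_of_le_one_right (abs_nonneg _) (hy k)
  have hsum' : ∀ x, Summable fun k => φ k x • y k := fun x =>
    Summable.of_norm_bounded (hsum x) (hle x)
  have hbound : ∀ x, ‖∑' k, φ k x • y k‖ ≤ ∑' k, |φ k x| := fun x =>
    tsum_of_norm_bounded (hsum x).hasSum (hle x)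
  let L : X →ₗ[ℝ] Y :=
    { toFun := fun x => ∑' k, φ k x • y k
      map_add' := fun x z => by
        simp only [map_add, add_smul]
        exact (hsum' x).tsum_add (hsum' z)
      map_smul' := fun c x => by
        simp only [map_smul, smul_assoc, RingHom.id_apply]
        exact (hsum' x).tsum_const_smul c }
  exact ⟨L.mkContinuous M fun x => (hbound x).trans
    (Real.tsum_le_of_sum_le (fun k => abs_nonneg _) (hφ x)),
    fun x => (hsum' x).hasSum, hbound⟩

/-- Each bounded multiplier `s` yields a functional `x ↦ ∑ s k * φ k x`, to which weak nullity
applies; Schur's theorem does the rest. -/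
theorem WeaklyNull.tendsto_tsum_abs {X : Type*} [NormedAddCommGroup X] [NormedSpace ℝ X]
    {φ : ℕ → StrongDual ℝ X} {M : ℝ}
    (hφ : ∀ (x : X) (s : Finset ℕ), ∑ k ∈ s, |φ k x| ≤ M * ‖x‖) {x : ℕ → X}
    (hx : WeaklyNull x) : Tendsto (fun n => ∑' k, |φ k (x n)|) atTop (𝓝 0) := by
  refine tendsto_tsum_abs_of_forall_tendsto_tsum_mul
    (fun n => summable_of_sum_le (fun k => abs_nonneg _) (hφ (x n))) fun s hs => ?_
  obtain ⟨S, hS, -⟩ := exists_clm_hasSum_smul hφ (y := s) hs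
  refine (hx.tendsto_apply S).congr fun n => ?_
  simp_rw [← (hS (x n)).tsum_eq, smul_eq_mul, mul_comm]

theorem isWeakDunfordPettis_of_norm_le_tsum {X Y : Type*} [NormedAddCommGroup X]
    [NormedSpace ℝ X] [NormedAddCommGroup Y] [NormedSpace ℝ Y] [CompleteSpace Y]
    {φ : ℕ → StrongDual ℝ X} {M : ℝ}
    (hφ : ∀ (x : X) (s : Finset ℕ), ∑ k ∈ s, |φ k x| ≤ M * ‖x‖) {T : X →L[ℝ] Y}
    (hT : ∀ x, ‖T x‖ ≤ ∑' k, |φ k x|) : IsWeakDunfordPettis T := by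
  intro x f hx hf
  obtain ⟨C, hC⟩ := hf.exists_norm_le
  have hlim := (hx.tendsto_tsum_abs hφ).const_mul C
  rw [mul_zero] at hlim
  refine squeeze_zero_norm (fun n => ?_) hlim
  calc ‖f n (T (x n))‖ ≤ ‖f n‖ * ‖T (x n)‖ := (f n).le_opNorm _
    _ ≤ C * ∑' k, |φ k (x n)| :=
      mul_le_mul (hC n) (hT _) (norm_nonneg _) ((norm_nonneg _).trans (hC n))

/-! ### Diagonal estimate and choice of subsequences -/

/-- The term `k = n` has size at least `δ * ε`. Terms before it cost at most `M * η` because `b` is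
small there, terms after it at most `C * η` because `a` has little mass there. -/
theorem sub_le_tsum_mul {a b : ℕ → ℝ} {n : ℕ} {δ ε M C η : ℝ} (ha : ∀ k, 0 ≤ a k)
    (hsum : ∀ s : Finset ℕ, ∑ k ∈ s, a k ≤ M) (han : δ ≤ a n) (hε : 0 ≤ ε) (hbn : ε ≤ |b n|)
    (hC : ∀ k, |b k| ≤ C) (hlt : ∀ k < n, |b k| ≤ η)
    (hgt : ∀ s : Finset ℕ, (∀ k ∈ s, n < k) → ∑ k ∈ s, a k ≤ η) (hη : 0 ≤ η) :
    δ * ε - (M + C) * η ≤ |∑' k, a k * b k| := by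
  have hC0 : 0 ≤ C := (abs_nonneg _).trans (hC 0)
  have hsa : Summable a := summable_of_sum_le ha hsum
  have habs : ∀ k, |a k * b k| = a k * |b k| := fun k => by rw [abs_mul, abs_of_nonneg (ha k)]
  have hsab : Summable fun k => a k * b k :=
    Summable.of_norm_bounded (hsa.mul_right C) fun k => by
      rw [Real.norm_eq_abs, habs]
      exact mul_le_mul_of_nonneg_left (hC k) (ha k)
  have hfirst : |∑ k ∈ Finset.range n, a k * b k| ≤ M * η := by
    refine (Finset.abs_sum_le_sum_abs _ _).trans ?_
    calc ∑ k ∈ Finset.range n, |a k * b k| ≤ ∑ k ∈ Finset.range n, a k * η :=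
          Finset.sum_le_sum fun k hk => by
            rw [habs]
            exact mul_le_mul_of_nonneg_left (hlt k (Finset.mem_range.1 hk)) (ha k)
      _ ≤ M * η := by
          rw [← Finset.sum_mul]
          exact mul_le_mul_of_nonneg_right (hsum _) hη
  have htail : |∑' k, a (k + (n + 1)) * b (k + (n + 1))| ≤ η * C := by
    have h1 : ∑' k, a (k + (n + 1)) ≤ η :=
      Real.tsum_le_of_sum_le (fun k => ha _) fun s => by
        have := hgt (s.map (addRightEmbedding (n + 1))) fun k hk => by
          obtain ⟨j, -, rfl⟩ := Finset.mem_map.1 hk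
          simp only [addRightEmbedding_apply]
          omega
        simpa using this
    have h2 : Summable fun k => a (k + (n + 1)) := (summable_nat_add_iff (n + 1)).2 hsa
    rw [← Real.norm_eq_abs]
    refine (tsum_of_norm_bounded (h2.mul_right C).hasSum fun k => ?_).trans ?_
    · rw [Real.norm_eq_abs, habs]
      exact mul_le_mul_of_nonneg_left (hC _) (ha _)
    · rw [tsum_mul_right]
      exact mul_le_mul_of_nonneg_right h1 hC0
  have hdiag : δ * ε ≤ |a n * b n| := by
    rw [habs]
    exact mul_le_mul han hbn hε (ha n)
  have hsplit := hsab.sum_add_tsum_nat_add (n + 1)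
  rw [Finset.sum_range_succ] at hsplit
  rw [← hsplit]
  have h3 := abs_sub_abs_le_abs_sub (a n * b n)
    (-(∑ k ∈ Finset.range n, a k * b k + ∑' k, a (k + (n + 1)) * b (k + (n + 1))))
  rw [abs_neg, sub_neg_eq_add] at h3
  have h4 := abs_add_le (∑ k ∈ Finset.range n, a k * b k)
    (∑' k, a (k + (n + 1)) * b (k + (n + 1)))
  have h5 : ∑ k ∈ Finset.range n, a k * b k + a n * b n
      + ∑' k, a (k + (n + 1)) * b (k + (n + 1)) = a n * b n +
      (∑ k ∈ Finset.range n, a k * b k + ∑' k, a (k + (n + 1)) * b (k + (n + 1))) := by ring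
  rw [h5]
  linarith

/-- If for each `m` the relation `r m n` holds for all large `n`, then it holds on all increasing
pairs from some subsequence. -/
theorem exists_strictMono_forall_lt {r : ℕ → ℕ → Prop} (h : ∀ m, ∀ᶠ n in atTop, r m n) :
    ∃ σ : ℕ → ℕ, StrictMono σ ∧ ∀ m n, m < n → r (σ m) (σ n) := by
  obtain ⟨σ, -, hσ⟩ := exists_seq_of_forall_finset_exists (fun _ : ℕ => True)
    (fun m n => m < n ∧ r m n) fun s _ => by
      have : ∀ᶠ n in atTop, ∀ m ∈ s, m < n ∧ r m n :=
        (Finset.eventually_all s).2 fun m _ => (eventually_gt_atTop m).and (h m)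
      obtain ⟨n, hn⟩ := this.exists
      exact ⟨n, trivial, hn⟩
  exact ⟨σ, fun m n hmn => (hσ m n hmn).1, fun m n hmn => (hσ m n hmn).2⟩

theorem exists_tail_sum_le {a : ℕ → ℝ} (ha : Summable a) {η : ℝ} (hη : 0 < η) :
    ∀ᶠ N in atTop, ∀ s : Finset ℕ, (∀ k ∈ s, N ≤ k) → ∑ k ∈ s, a k ≤ η := by
  obtain ⟨t, ht⟩ := summable_iff_vanishing_norm.1 ha η hη
  filter_upwards [(Finset.eventually_all t).2 fun m _ => eventually_gt_atTop m] with N hN s hs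
  refine (le_abs_self _).trans (ht s (Finset.disjoint_left.2 fun k hk hkt => ?_)).le
  exact absurd (hs k hk) (not_le.2 (hN k hkt))

/-! ### Positive witnesses in Banach lattices -/

section BanachLattice

variable {E : Type*} [NormedAddCommGroup E] [NormedSpace ℝ E] [Lattice E]
  [IsOrderedAddMonoid E]

theorem abs_apply_le_apply_abs {φ : StrongDual ℝ E} (hφ : 0 ≤ φ) (x : E) : |φ x| ≤ φ |x| := by
  have hmono : ∀ {x y : E}, x ≤ y → φ x ≤ φ y := fun {x y} hxy => by
    have := hφ (y - x) (sub_nonneg.2 hxy)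
    simpa using this
  rw [abs_le, neg_le, ← map_neg]
  exact ⟨hmono (neg_le_abs x), hmono (le_abs_self x)⟩

variable [HasSolidNorm E]

theorem exists_nonneg_lt_apply {φ : StrongDual ℝ E} (hφ : 0 ≤ φ) {r : ℝ} (hr : r < ‖φ‖) :
    ∃ u : E, 0 ≤ u ∧ ‖u‖ ≤ 1 ∧ r < φ u := by
  obtain ⟨x, hx, hrx⟩ := φ.exists_lt_apply_of_lt_opNorm hr
  exact ⟨|x|, abs_nonneg x, (norm_abs_eq_norm x).trans_le hx.le,
    hrx.trans_le (abs_apply_le_apply_abs hφ x)⟩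

theorem exists_nonneg_half_lt_abs_apply (f : StrongDual ℝ E) {r : ℝ} (hr : 2 * r < ‖f‖) :
    ∃ u : E, 0 ≤ u ∧ ‖u‖ ≤ 1 ∧ r < |f u| := by
  obtain ⟨x, hx, hrx⟩ := f.exists_lt_apply_of_lt_opNorm hr
  have hnorm : ∀ y : E, 0 ≤ y → y ≤ |x| → ‖y‖ ≤ 1 := fun y hy hyx =>
    (norm_le_norm_of_abs_le_abs (by rwa [abs_of_nonneg hy])).trans hx.le
  have hpos : x⁺ ≤ |x| := by
    rw [← posPart_add_negPart x]; exact le_add_of_nonneg_right (negPart_nonneg x)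
  have hneg : x⁻ ≤ |x| := by
    rw [← posPart_add_negPart x]; exact le_add_of_nonneg_left (posPart_nonneg x)
  -- One of `x⁺`, `x⁻` carries at least half of `|f x|`; hence the factor `2` in `hr`.
  by_cases h : r < |f x⁺|
  · exact ⟨x⁺, posPart_nonneg x, hnorm _ (posPart_nonneg x) hpos, h⟩
  · refine ⟨x⁻, negPart_nonneg x, hnorm _ (negPart_nonneg x) hneg, ?_⟩
    rw [Real.norm_eq_abs, ← posPart_sub_negPart x, map_sub] at hrx
    have := abs_sub (f x⁺) (f x⁻)
    linarith

/-- In a dual Banach lattice that is not a KB-space there is a sequence of positive functionals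
that is bounded away from `0`, with norm bounded sums. -/
theorem exists_seq_of_not_isKBSpace (h : ¬ IsKBSpace (StrongDual ℝ E)) :
    ∃ (φ : ℕ → StrongDual ℝ E) (M δ : ℝ), 0 < δ ∧ (∀ k, 0 ≤ φ k) ∧ (∀ k, δ < ‖φ k‖) ∧
      ∀ (x : E) (s : Finset ℕ), ∑ k ∈ s, |φ k x| ≤ M * ‖x‖ := by
  unfold IsKBSpace at h
  push Not at h
  obtain ⟨g, hmono, -, hbdd, hlim⟩ := h
  have hnc : ¬ CauchySeq g := fun hc =>
    let ⟨l, hl⟩ := cauchySeq_tendsto_of_complete hc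
    hlim l hl
  rw [Metric.cauchySeq_iff'] at hnc
  push Not at hnc
  obtain ⟨ε, hε, hg⟩ := hnc
  choose next hnext_le hnext using hg
  obtain ⟨C, hC⟩ := hbdd.exists_norm_le
  let ν : ℕ → ℕ := fun k => next^[k] 0
  have hν : ∀ k, ν (k + 1) = next (ν k) := fun k => Function.iterate_succ_apply' _ _ _
  have hφ : ∀ k, 0 ≤ g (ν (k + 1)) - g (ν k) := fun k x hx => by
    have := hmono (hν k ▸ hnext_le (ν k) : ν k ≤ ν (k + 1)) x hx
    simpa using this
  refine ⟨fun k => g (ν (k + 1)) - g (ν k), 2 * C, ε / 2, by linarith, hφ, fun k => ?_,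
    fun x s => ?_⟩
  · rw [← dist_eq_norm, hν]
    linarith [hnext (ν k)]
  · obtain ⟨N, hN⟩ := s.exists_nat_subset_range
    calc ∑ k ∈ s, |(g (ν (k + 1)) - g (ν k)) x|
        ≤ ∑ k ∈ Finset.range N, |(g (ν (k + 1)) - g (ν k)) x| :=
          Finset.sum_le_sum_of_subset_of_nonneg hN fun _ _ _ => abs_nonneg _
      _ ≤ ∑ k ∈ Finset.range N, (g (ν (k + 1)) |x| - g (ν k) |x|) :=
          Finset.sum_le_sum fun k _ => abs_apply_le_apply_abs (hφ k) x
      _ = (g (ν N) - g (ν 0)) |x| := by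
          rw [Finset.sum_range_sub fun k => g (ν k) |x|]; rfl
      _ ≤ ‖g (ν N) - g (ν 0)‖ * ‖|x|‖ :=
          (Real.le_norm_self _).trans (ContinuousLinearMap.le_opNorm _ _)
      _ ≤ 2 * C * ‖x‖ := by
          rw [norm_abs_eq_norm]
          refine mul_le_mul_of_nonneg_right ((norm_sub_le _ _).trans ?_) (norm_nonneg x)
          linarith [hC _ ⟨ν N, rfl⟩, hC _ ⟨ν 0, rfl⟩]

/-- If the dual of a Banach lattice fails the Schur property, this is witnessed on positive
elements of the unit ball. -/
theorem exists_seq_of_not_hasSchurProperty (h : ¬ HasSchurProperty (StrongDual ℝ E)) :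
    ∃ (f : ℕ → StrongDual ℝ E) (y : ℕ → E) (ε : ℝ), 0 < ε ∧ WeaklyNull f ∧
      (∀ k, 0 ≤ y k) ∧ (∀ k, ‖y k‖ ≤ 1) ∧ ∀ k, ε < |f k (y k)| := by
  unfold HasSchurProperty at h
  push Not at h
  obtain ⟨f, hf, hlim⟩ := h
  rw [Metric.tendsto_atTop] at hlim
  push Not at hlim
  obtain ⟨ε, hε, hlim⟩ := hlim
  obtain ⟨σ, hσ, hfσ⟩ := extraction_of_frequently_atTop (frequently_atTop.2 hlim)
  have hy : ∀ k, ∃ u : E, 0 ≤ u ∧ ‖u‖ ≤ 1 ∧ ε / 4 < |f (σ k) u| := fun k =>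
    exists_nonneg_half_lt_abs_apply _ (by
      have := hfσ k
      rw [Real.dist_0_eq_abs, abs_norm] at this
      linarith)
  choose y hy0 hy1 hy2 using hy
  exact ⟨f ∘ σ, y, ε / 4, by linarith, hf.comp hσ.tendsto_atTop, hy0, hy1, hy2⟩

end BanachLattice

/-! ### The operator that is not limited -/

theorem IsLimitedOperator.tendsto_apply {X Y : Type*} [NormedAddCommGroup X] [NormedSpace ℝ X]
    [NormedAddCommGroup Y] [NormedSpace ℝ Y] {T : X →L[ℝ] Y} (hT : IsLimitedOperator T)
    {f : ℕ → StrongDual ℝ Y} (hf : WeakStarNull f) {u : ℕ → X} (hu : ∀ n, ‖u n‖ ≤ 1) :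
    Tendsto (fun n => f n (T (u n))) atTop (𝓝 0) := by
  rw [Metric.tendsto_nhds]
  intro ε hε
  filter_upwards [Metric.tendstoUniformlyOn_iff.1 (hT.2 f hf) ε hε] with n hn
  rw [dist_comm]
  exact hn _ ⟨u n, by simpa using hu n, rfl⟩

theorem mainTheorem5
    {E : Type*} [NormedAddCommGroup E] [NormedSpace ℝ E] [CompleteSpace E]
    [Lattice E] [IsOrderedAddMonoid E] [IsOrderedModule ℝ E] [HasSolidNorm E]
    {F : Type*} [NormedAddCommGroup F] [NormedSpace ℝ F] [CompleteSpace F]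
    [Lattice F] [IsOrderedAddMonoid F] [IsOrderedModule ℝ F] [HasSolidNorm F]
    (h : ∀ T : E →L[ℝ] F, IsPositiveOperator T → IsWeakDunfordPettis T → IsLimitedOperator T) :
    IsKBSpace (StrongDual ℝ E) ∨ HasSchurProperty (StrongDual ℝ F) := by
  by_contra hcon
  rw [not_or] at hcon
  obtain ⟨φ₀, M, δ, hδ, hφ₀, hφδ, hφ₀sum⟩ := exists_seq_of_not_isKBSpace hcon.1
  obtain ⟨f₀, y₀, ε, hε, hf₀, hy₀, hy₀1, hfy⟩ := exists_seq_of_not_hasSchurProperty hcon.2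
  choose u₀ hu₀ hu₀1 hφu using fun k => exists_nonneg_lt_apply (hφ₀ k) (hφδ k)
  obtain ⟨C, hC⟩ := hf₀.exists_norm_le
  have hC0 : 0 ≤ C := (norm_nonneg _).trans (hC 0)
  have hM : ∀ x : E, ‖x‖ ≤ 1 → M * ‖x‖ ≤ |M| := fun x hx =>
    (le_abs_self _).trans (by
      rw [abs_mul, abs_norm]
      exact mul_le_of_le_one_right (abs_nonneg M) hx)
  obtain ⟨η, hη, hηle⟩ : ∃ η > 0, (|M| + C) * η ≤ δ * ε / 2 := by
    have hpos : 0 < |M| + C + 1 := by positivity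
    refine ⟨δ * ε / 2 / (|M| + C + 1), by positivity, ?_⟩
    rw [mul_div_assoc', div_le_iff₀ hpos, mul_comm]
    exact mul_le_mul_of_nonneg_left (by linarith) (by positivity)
  -- `σ` controls the terms after the diagonal, `τ` those before it. The two can be chosen
  -- independently, since `T` pairs `φ₀ (σ k)` with `y₀ (τ k)`.
  obtain ⟨σ, hσ, hσ_tail⟩ := exists_strictMono_forall_lt fun m => exists_tail_sum_le
    ((summable_of_sum_le (fun k => abs_nonneg _) (hφ₀sum (u₀ m))).of_abs) hη
  obtain ⟨τ, hτ, hτ_small⟩ := exists_strictMono_forall_lt fun m =>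
    ((hf₀.tendsto_apply_apply (y₀ m)).abs.eventually_le_const (by simpa using hη))
  have hφsum : ∀ (x : E) (s : Finset ℕ), ∑ k ∈ s, |φ₀ (σ k) x| ≤ M * ‖x‖ := fun x s => by
    simpa using hφ₀sum x (s.map ⟨σ, hσ.injective⟩)
  obtain ⟨T, hT, hTle⟩ := exists_clm_hasSum_smul hφsum (y := y₀ ∘ τ) fun k => hy₀1 _
  have hTpos : IsPositiveOperator T := fun x hx =>
    (hT x).nonneg fun k => smul_nonneg (hφ₀ _ x hx) (hy₀ _)
  have hTlim := h T hTpos (isWeakDunfordPettis_of_norm_le_tsum hφsum hTle)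
  have hf : WeaklyNull (f₀ ∘ τ) := hf₀.comp hτ.tendsto_atTop
  have hlim := hTlim.tendsto_apply hf.weakStarNull (u := u₀ ∘ σ) fun n => hu₀1 _
  have hlower : ∀ n, δ * ε / 2 ≤ |f₀ (τ n) (T (u₀ (σ n)))| := fun n => by
    have heq : f₀ (τ n) (T (u₀ (σ n)))
        = ∑' k, φ₀ (σ k) (u₀ (σ n)) * f₀ (τ n) (y₀ (τ k)) := by
      refine (((hT (u₀ (σ n))).mapL (f₀ (τ n))).tsum_eq.symm).trans ?_
      simp
    rw [heq]
    refine le_trans ?_ (sub_le_tsum_mul (n := n) (δ := δ) (ε := ε) (M := |M|) (C := C) (η := η)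
      (fun k => hφ₀ _ _ (hu₀ _)) (fun s => ?_) (hφu _).le hε.le (hfy _).le (fun k => ?_)
      (fun k hk => hτ_small k n hk) (fun s hs => ?_) hη.le)
    · linarith
    · refine le_trans (Finset.sum_le_sum fun k _ => le_abs_self _) ?_
      exact (hφsum _ s).trans (hM _ (hu₀1 _))
    · calc |f₀ (τ n) (y₀ (τ k))| ≤ ‖f₀ (τ n)‖ * ‖y₀ (τ k)‖ := (f₀ (τ n)).le_opNorm _
        _ ≤ C * 1 := mul_le_mul (hC _) (hy₀1 _) (norm_nonneg _) hC0
        _ = C := mul_one C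
    -- The tail starts at `σ (n + 1)`, which covers every `σ j` with `n < j`.
    · have := hσ_tail n (n + 1) n.lt_succ_self (s.map ⟨σ, hσ.injective⟩) fun k hk => by
        obtain ⟨j, hj, rfl⟩ := Finset.mem_map.1 hk
        exact hσ.monotone (hs j hj)
      simpa using this
  have hle := ge_of_tendsto' hlim.abs hlower
  rw [abs_zero] at hle
  have : 0 < δ * ε := mul_pos hδ hε
  linarith
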